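/- Let $d_1,d_2\ge 1$ and let $f:\mathbb R^{d_1}\times\mathbb R^{d_2}\to\mathbb R$ be differentiable. Suppose that: (i) there is $l>0$ with $\|\nabla_x f(x_1,y_1)-\nabla_x f(x_2,y_2)\|\le l(\|x_1-x_2\|+\|y_1-y_2\|)$ and $\|\nabla_y f(x_1,y_1)-\nabla_y f(x_2,y_2)\|\le l(\|x_1-x_2\|+\|y_1-y_2\|)$ for all $x_1,x_2,y_1,y_2$; (ii) for every $x$ the maximum $\Phi(x)=\max_y f(x,y)$ is attained, and there is $\mu>0$ with $\|\nabla_y f(x,y)\|^2\ge 2\mu\,[\Phi(x)-f(x,y)]$ for all $x,y$ (the Polyak–Łojasiewicz condition in $y$); (iii) $\Phi^*=\min_x\Phi(x)$ exists and is finite. Put $L=l+\frac{l^2}{2\mu}$ and $\kappa=\frac{l}{\mu}$. Let $\varepsilon>0$, and let $\alpha,\beta>0$ satisfy $$\beta\le\frac1{4d_2L},\qquad \alpha\le\min\Big\{\frac{\beta}{32\kappa^2},\frac1{10d_1L}\Big\}.$$ Put $\theta_1=\big(5d_1L+\frac{3}{2\alpha}+\frac32L+d_2L\big)d_1^2L^2\alpha^2$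 and take the smoothing radii $$\mu_1=\frac{\sqrt{\alpha}\,\varepsilon}{2\sqrt{\theta_1}},\qquad \mu_2=\frac{\sqrt\alpha\,\varepsilon}{\sqrt{3\beta}\,d_2L}.$$ Let $u_0,u_1,\dots$ and $v_0,v_1,\dots$ be mutually independent random vectors, each $u_t$ uniformly distributed on the unit sphere of $\mathbb R^{d_1}$ and each $v_t$ uniformly distributed on the unit sphere of $\mathbb R^{d_2}$. From a deterministic starting point $(x_0,y_0)$, the ZO-AGDA algorithm generates, for $t=0,1,2,\dots$, $$x_{t+1}=x_t-\alpha\,\frac{f(x_t+\mu_1u_t,y_t)-f(x_t,y_t)}{\mu_1/d_1}\,u_t,\qquad y_{t+1}=y_t+\beta\,\frac{f(x_{t+1},y_t+\mu_2v_t)-f(x_{t+1},y_t)}{\mu_2/d_2}\,v_t .$$ Then $\Phi$ is differentiable, $\mathbb E\|\nabla\Phi(x_t)\|<\infty$ for all $t$, and $T(\varepsilon):=\min\{t\ge0:\ \mathbb E\|\nabla\Phi(x_t)\|\le\varepsilon\}$ exists and satisfies $$T(\varepsilon)\le\frac{4\,[\,3\Phi(x_0)-f(x_0,y_0)-2\Phi^*\,]}{\alpha\,\varepsilon^2}.$$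 (For fixed $\alpha$ and $\beta$, only $\varepsilon^2$ in this bound depends on $\varepsilon$, so $T(\varepsilon)=\mathcal O(\varepsilon^{-2})$.) -/

import Mathlib

open MeasureTheory ProbabilityTheory

/-- The uniform probability distribution on the unit sphere of `ℝ^d`, as a measure on `ℝ^d`:
the normalized surface measure, pushed forward along the inclusion of the sphere. -/
noncomputable def uniformSphere (d : ℕ) : Measure (EuclideanSpace ℝ (Fin d)) :=
  (((volume : Measure (EuclideanSpace ℝ (Fin d))).toSphere Set.univ)⁻¹ •
    (volume : Measure (EuclideanSpace ℝ (Fin d))).toSphere).map Subtype.val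

section Minimax

/-- The primal function `Φ(x) = max_y f(x, y)`; it is the maximum whenever that is attained. -/
noncomputable def primalFun {X Y : Type*} (f : X → Y → ℝ) (x : X) : ℝ :=
  ⨆ y, f x y

/-- The partial gradient `∇_x f(x, y)`. -/
noncomputable def gradX {d₁ d₂ : ℕ}
    (f : EuclideanSpace ℝ (Fin d₁) → EuclideanSpace ℝ (Fin d₂) → ℝ)
    (x : EuclideanSpace ℝ (Fin d₁)) (y : EuclideanSpace ℝ (Fin d₂)) :
    EuclideanSpace ℝ (Fin d₁) :=
  gradient (fun x' => f x' y) x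

/-- The partial gradient `∇_y f(x, y)`. -/
noncomputable def gradY {d₁ d₂ : ℕ}
    (f : EuclideanSpace ℝ (Fin d₁) → EuclideanSpace ℝ (Fin d₂) → ℝ)
    (x : EuclideanSpace ℝ (Fin d₁)) (y : EuclideanSpace ℝ (Fin d₂)) :
    EuclideanSpace ℝ (Fin d₂) :=
  gradient (fun y' => f x y') y

/-- `f` is differentiable and both partial gradients are Lipschitz continuous with constant `l`
(with respect to the sum of the norms of the two blocks). -/
structure HasLipschitzGradients {d₁ d₂ : ℕ}
    (f : EuclideanSpace ℝ (Fin d₁) → EuclideanSpace ℝ (Fin d₂) → ℝ) (l : ℝ) : Prop where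
  differentiable : Differentiable ℝ
    (fun p : EuclideanSpace ℝ (Fin d₁) × EuclideanSpace ℝ (Fin d₂) => f p.1 p.2)
  gradX_le : ∀ x₁ x₂ y₁ y₂,
    ‖gradX f x₁ y₁ - gradX f x₂ y₂‖ ≤ l * (‖x₁ - x₂‖ + ‖y₁ - y₂‖)
  gradY_le : ∀ x₁ x₂ y₁ y₂,
    ‖gradY f x₁ y₁ - gradY f x₂ y₂‖ ≤ l * (‖x₁ - x₂‖ + ‖y₁ - y₂‖)

/-- For every `x` the maximum of `f(x, ·)` is attained, and `f` satisfies the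
Polyak-Łojasiewicz condition in `y` with constant `μ`. -/
structure IsPLInY {d₁ d₂ : ℕ}
    (f : EuclideanSpace ℝ (Fin d₁) → EuclideanSpace ℝ (Fin d₂) → ℝ) (μ : ℝ) : Prop where
  max_attained : ∀ x, ∃ ystar, ∀ y, f x y ≤ f x ystar
  pl : ∀ x y, 2 * μ * (primalFun f x - f x y) ≤ ‖gradY f x y‖ ^ 2

/-- The zeroth-order estimator of `∇_x f(x, y)` in direction `u` with smoothing radius `μ₁`. -/
noncomputable def zoGradX {d₁ d₂ : ℕ}
    (f : EuclideanSpace ℝ (Fin d₁) → EuclideanSpace ℝ (Fin d₂) → ℝ) (μ₁ : ℝ)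
    (x : EuclideanSpace ℝ (Fin d₁)) (y : EuclideanSpace ℝ (Fin d₂))
    (u : EuclideanSpace ℝ (Fin d₁)) : EuclideanSpace ℝ (Fin d₁) :=
  ((f (x + μ₁ • u) y - f x y) / (μ₁ / (d₁ : ℝ))) • u

/-- The zeroth-order estimator of `∇_y f(x, y)` in direction `v` with smoothing radius `μ₂`. -/
noncomputable def zoGradY {d₁ d₂ : ℕ}
    (f : EuclideanSpace ℝ (Fin d₁) → EuclideanSpace ℝ (Fin d₂) → ℝ) (μ₂ : ℝ)
    (x : EuclideanSpace ℝ (Fin d₁)) (y : EuclideanSpace ℝ (Fin d₂))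
    (v : EuclideanSpace ℝ (Fin d₂)) : EuclideanSpace ℝ (Fin d₂) :=
  ((f x (y + μ₂ • v) - f x y) / (μ₂ / (d₂ : ℝ))) • v

/-- The iterates `(x_t, y_t)` of ZO-AGDA started at `(x₀, y₀)`, for given sequences of
directions `u`, `v`: a descent step in `x`, then an ascent step in `y` at the new `x`. -/
noncomputable def zoAGDA {d₁ d₂ : ℕ}
    (f : EuclideanSpace ℝ (Fin d₁) → EuclideanSpace ℝ (Fin d₂) → ℝ) (α β μ₁ μ₂ : ℝ)
    (x₀ : EuclideanSpace ℝ (Fin d₁)) (y₀ : EuclideanSpace ℝ (Fin d₂))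
    (u : ℕ → EuclideanSpace ℝ (Fin d₁)) (v : ℕ → EuclideanSpace ℝ (Fin d₂)) :
    ℕ → EuclideanSpace ℝ (Fin d₁) × EuclideanSpace ℝ (Fin d₂)
  | 0 => (x₀, y₀)
  | t + 1 =>
    let p := zoAGDA f α β μ₁ μ₂ x₀ y₀ u v t
    let xnext := p.1 - α • zoGradX f μ₁ p.1 p.2 (u t)
    (xnext, p.2 + β • zoGradY f μ₂ xnext p.2 (v t))

end Minimax

/-!
By the Polyak-Łojasiewicz inequality `Φ` exceeds `f(·, y)`, for `y` a maximizer at `x`, by a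
quadratic error only, so `Φ` is smooth with `∇Φ(x) = ∇_x f(x, y)`. Away from the maximizers the
error `∇_x f(x, y) - ∇Φ(x)` is still controlled by `∇_y f(x, y)`: the nonnegative smooth function
`Φ(x) - f(x, y)` bounds the squares of its own partial gradients, and is in turn bounded by
`‖∇_y f(x, y)‖ ^ 2`.

A zeroth-order step along a unit vector `w` moves by about the derivative `⟪∇g, w⟫` along `w`, and
the mean of `⟪∇g, w⟫ ^ 2` over the unit sphere is `‖∇g‖ ^ 2 / d`. Since each new direction is
independent of the past, the potential `2 * Φ(x) + (Φ(x) - f(x, y))` therefore decreases in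
expectation at each iteration by `α * 𝔼 ‖∇Φ(x)‖ ^ 2` up to the difference-quotient errors: the
ascent step gains `β / 2 * ‖∇_y f‖ ^ 2`, which pays for using `∇_x f` in place of `∇Φ`. As long as
`𝔼 ‖∇Φ(x)‖ > ε`, Jensen's inequality turns this into a decrease by `α * ε ^ 2 / 4`, and the
potential is bounded below by `2 * Φ^*`.
-/

section UniformSphere

open scoped Pointwise

variable {d : ℕ}

theorem uniformSphere_apply {s : Set (EuclideanSpace ℝ (Fin d))} (hs : MeasurableSet s) :
    uniformSphere d s =
      ((volume : Measure (EuclideanSpace ℝ (Fin d))).toSphere Set.univ)⁻¹ *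
        (d * volume (Set.Ioo (0 : ℝ) 1 • (s ∩ Metric.sphere 0 1))) := by
  rw [uniformSphere, Measure.map_apply measurable_subtype_coe hs, Measure.smul_apply,
    Measure.toSphere_apply' _ (measurable_subtype_coe hs), Subtype.image_preimage_coe,
    finrank_euclideanSpace_fin, smul_eq_mul, Set.inter_comm]

instance isProbabilityMeasure_uniformSphere [NeZero d] :
    IsProbabilityMeasure (uniformSphere d) where
  measure_univ := by
    rw [uniformSphere, Measure.map_apply measurable_subtype_coe MeasurableSet.univ,
      Set.preimage_univ, Measure.smul_apply, smul_eq_mul,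
      ENNReal.inv_mul_cancel (Measure.measure_univ_ne_zero.2 (Measure.toSphere_ne_zero _))
        (measure_ne_top _ _)]

theorem ae_norm_eq_one_uniformSphere : ∀ᵐ w ∂(uniformSphere d), ‖w‖ = 1 := by
  rw [uniformSphere, ae_map_iff measurable_subtype_coe.aemeasurable
    (measurableSet_eq_fun measurable_norm measurable_const)]
  exact Filter.Eventually.of_forall norm_eq_of_mem_sphere

theorem map_linearIsometryEquiv_uniformSphere
    (R : EuclideanSpace ℝ (Fin d) ≃ₗᵢ[ℝ] EuclideanSpace ℝ (Fin d)) :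
    (uniformSphere d).map R = uniformSphere d := by
  ext s hs
  have hR : Measurable R := R.continuous.measurable
  have cone_preimage : Set.Ioo (0 : ℝ) 1 • (R ⁻¹' s ∩ Metric.sphere 0 1) =
      R ⁻¹' (Set.Ioo (0 : ℝ) 1 • (s ∩ Metric.sphere 0 1)) := by
    ext w
    simp only [Set.mem_smul, Set.mem_inter_iff, Set.mem_preimage, mem_sphere_zero_iff_norm]
    constructor
    · rintro ⟨c, hc, z, ⟨hz, hz1⟩, rfl⟩
      exact ⟨c, hc, R z, ⟨hz, by rwa [R.norm_map]⟩, (map_smul R c z).symm⟩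
    · rintro ⟨c, hc, z, ⟨hz, hz1⟩, h⟩
      refine ⟨c, hc, R.symm z, ⟨by rwa [R.apply_symm_apply], by rwa [R.symm.norm_map]⟩, ?_⟩
      rw [← map_smul, h, R.symm_apply_apply]
  rw [Measure.map_apply hR hs, uniformSphere_apply (hR hs), uniformSphere_apply hs, cone_preimage,
    (LinearIsometryEquiv.measurePreserving R).measure_preimage_emb
      R.toHomeomorph.measurableEmbedding]

theorem integral_inner_sq_uniformSphere_congr {a b : EuclideanSpace ℝ (Fin d)} (h : ‖a‖ = ‖b‖) :
    ∫ w, inner ℝ a w ^ 2 ∂(uniformSphere d) = ∫ w, inner ℝ b w ^ 2 ∂(uniformSphere d) := by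
  obtain ⟨R, rfl⟩ : ∃ R : EuclideanSpace ℝ (Fin d) ≃ₗᵢ[ℝ] EuclideanSpace ℝ (Fin d), R a = b :=
    ⟨_, Submodule.reflection_sub h⟩
  conv_rhs => rw [← map_linearIsometryEquiv_uniformSphere R]
  rw [integral_map R.continuous.measurable.aemeasurable
    (Continuous.aestronglyMeasurable (by fun_prop))]
  simp only [LinearIsometryEquiv.inner_map_map]

variable [NeZero d]

theorem integrable_uniformSphere_of_continuous {F : EuclideanSpace ℝ (Fin d) → ℝ}
    (hF : Continuous F) : Integrable F (uniformSphere d) := by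
  obtain ⟨C, hC⟩ := (isCompact_sphere (0 : EuclideanSpace ℝ (Fin d)) 1).exists_bound_of_continuousOn
    hF.continuousOn
  refine Integrable.of_bound (C := C) hF.aestronglyMeasurable ?_
  filter_upwards [ae_norm_eq_one_uniformSphere] with w hw using hC w (mem_sphere_zero_iff_norm.2 hw)

/- By rotation invariance all `⟪a, w⟫` with `‖a‖` fixed have the same second moment, and over an
orthonormal basis these second moments add up to `‖a‖ ^ 2`. -/
theorem integral_inner_sq_uniformSphere (a : EuclideanSpace ℝ (Fin d)) :
    ∫ w, inner ℝ a w ^ 2 ∂(uniformSphere d) = ‖a‖ ^ 2 / d := by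
  let b := EuclideanSpace.basisFun (Fin d) ℝ
  have hb : ∀ i, ∫ w, inner ℝ (‖a‖ • b i) w ^ 2 ∂(uniformSphere d) =
      ∫ w, inner ℝ a w ^ 2 ∂(uniformSphere d) := fun i =>
    integral_inner_sq_uniformSphere_congr (by simp [norm_smul, b.norm_eq_one])
  have hsum_sq : ∀ᵐ w ∂(uniformSphere d), ∑ i, inner ℝ (‖a‖ • b i) w ^ 2 = ‖a‖ ^ 2 := by
    filter_upwards [ae_norm_eq_one_uniformSphere] with w hw
    simp_rw [real_inner_smul_left, mul_pow, ← Finset.mul_sum]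
    rw [b.sum_sq_inner_right, hw, one_pow, mul_one]
  have hsum : ∑ i, ∫ w, inner ℝ (‖a‖ • b i) w ^ 2 ∂(uniformSphere d) = ‖a‖ ^ 2 := by
    rw [← integral_finsetSum _ fun i _ => integrable_uniformSphere_of_continuous (by fun_prop),
      integral_congr_ae hsum_sq, integral_const, probReal_univ, one_smul]
  simp_rw [hb] at hsum
  rw [Finset.sum_const, Finset.card_univ, Fintype.card_fin, nsmul_eq_mul] at hsum
  rw [eq_div_iff (NeZero.ne _), mul_comm, hsum]

theorem integral_uniformSphere_le_of_le_inner_sq {F : EuclideanSpace ℝ (Fin d) → ℝ}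
    (hF : Continuous F) {p q : EuclideanSpace ℝ (Fin d)} {a b c : ℝ}
    (h : ∀ w, ‖w‖ = 1 → F w ≤ a + d * (b * inner ℝ p w ^ 2 + c * inner ℝ q w ^ 2)) :
    ∫ w, F w ∂(uniformSphere d) ≤ a + (b * ‖p‖ ^ 2 + c * ‖q‖ ^ 2) := by
  have integrable_inner_sq (p : EuclideanSpace ℝ (Fin d)) (b : ℝ) :
      Integrable (fun w => b * inner ℝ p w ^ 2) (uniformSphere d) :=
    integrable_uniformSphere_of_continuous (by fun_prop)
  calc ∫ w, F w ∂(uniformSphere d)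
    _ ≤ ∫ w, (a + d * (b * inner ℝ p w ^ 2 + c * inner ℝ q w ^ 2)) ∂(uniformSphere d) := by
        refine integral_mono_ae (integrable_uniformSphere_of_continuous hF)
          (integrable_uniformSphere_of_continuous (by fun_prop)) ?_
        filter_upwards [ae_norm_eq_one_uniformSphere] with w hw using h w hw
    _ = a + (b * ‖p‖ ^ 2 + c * ‖q‖ ^ 2) := by
        rw [integral_add (integrable_const _)
            (((integrable_inner_sq p b).fun_add (integrable_inner_sq q c)).const_mul _),
          integral_const_mul, integral_add (integrable_inner_sq p b) (integrable_inner_sq q c),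
          integral_const_mul, integral_const_mul, integral_inner_sq_uniformSphere,
          integral_inner_sq_uniformSphere, integral_const, probReal_univ, one_smul]
        have : (d : ℝ) ≠ 0 := NeZero.ne _
        field_simp

end UniformSphere

section QuadraticApprox

variable {E : Type*} [NormedAddCommGroup E] [InnerProductSpace ℝ E]
  {g g₁ g₂ : E → ℝ} {p p₁ p₂ x x₁ x₂ u : E} {M M₁ M₂ m : ℝ}

/-- The affine function with slope `p` approximates `g` around `x` up to the quadratic error
`M / 2 * ‖h‖ ^ 2`. Holding at every `x` with `p = ∇g(x)`, this is `M`-smoothness of `g`; the error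
bound is global in `h`, so that it also applies to finite differences. -/
def HasQuadraticApproxAt (g : E → ℝ) (p : E) (M : ℝ) (x : E) : Prop :=
  ∀ h, |g (x + h) - g x - inner ℝ p h| ≤ M / 2 * ‖h‖ ^ 2

/-- The forward difference quotient of `g` at `x` along `u` with increment `m`, which the
zeroth-order estimators use in place of the derivative along `u`. -/
noncomputable def diffQuot (g : E → ℝ) (m : ℝ) (x u : E) : ℝ :=
  (g (x + m • u) - g x) / m

theorem hasDerivAt_comp_add_smul [CompleteSpace E] (hg : Differentiable ℝ g) (x h : E) (s : ℝ) :
    HasDerivAt (fun s : ℝ => g (x + s • h)) (inner ℝ (gradient g (x + s • h)) h) s := by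
  have hline : HasDerivAt (fun s : ℝ => x + s • h) h s := by
    simpa using ((hasDerivAt_id s).smul_const h).const_add x
  refine ((hg (x + s • h)).hasGradientAt.hasFDerivAt.comp_hasDerivAt s hline).congr_deriv ?_
  simp

theorem hasQuadraticApproxAt_of_lipschitz_gradient [CompleteSpace E] (hg : Differentiable ℝ g)
    (hlip : ∀ x z, ‖gradient g x - gradient g z‖ ≤ M * ‖x - z‖) (x : E) :
    HasQuadraticApproxAt g (gradient g x) M x := by
  intro h
  have hrem : ∀ s : ℝ, HasDerivAt
      (fun s : ℝ => g (x + s • h) - g x - s * inner ℝ (gradient g x) h)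
      (inner ℝ (gradient g (x + s • h) - gradient g x) h) s := fun s => by
    simpa only [inner_sub_left, one_mul] using ((hasDerivAt_comp_add_smul hg x h s).sub_const
      (g x)).fun_sub ((hasDerivAt_id' s).mul_const (inner ℝ (gradient g x) h))
  have hbound : ∀ s : ℝ,
      HasDerivAt (fun s : ℝ => M / 2 * ‖h‖ ^ 2 * s ^ 2) (M * ‖h‖ ^ 2 * s) s := fun s => by
    refine ((hasDerivAt_pow 2 s).const_mul (M / 2 * ‖h‖ ^ 2)).congr_deriv ?_
    push_cast
    ring
  have hderiv_le : ∀ s ∈ Set.Ico (0 : ℝ) 1,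
      ‖(inner ℝ (gradient g (x + s • h) - gradient g x) h : ℝ)‖ ≤ M * ‖h‖ ^ 2 * s := by
    intro s hs
    calc ‖(inner ℝ (gradient g (x + s • h) - gradient g x) h : ℝ)‖
      _ ≤ ‖gradient g (x + s • h) - gradient g x‖ * ‖h‖ := norm_inner_le_norm _ _
      _ ≤ M * ‖x + s • h - x‖ * ‖h‖ := by gcongr; exact hlip _ _
      _ = M * ‖h‖ ^ 2 * s := by
          rw [add_sub_cancel_left, norm_smul, Real.norm_of_nonneg hs.1]
          ring
  simpa using image_norm_le_of_norm_deriv_right_le_deriv_boundary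
    (fun s _ => (hrem s).continuousAt.continuousWithinAt) (fun s _ => (hrem s).hasDerivWithinAt)
    (by simp) hbound hderiv_le (Set.right_mem_Icc.2 zero_le_one)

namespace HasQuadraticApproxAt

theorem hasGradientAt [CompleteSpace E] (h : HasQuadraticApproxAt g p M x) :
    HasGradientAt g p x := by
  rw [hasGradientAt_iff_isLittleO_nhds_zero]
  refine Asymptotics.IsBigO.trans_isLittleO ?_ (Asymptotics.isLittleO_norm_pow_id one_lt_two)
  refine Asymptotics.IsBigO.of_bound (M / 2) (Filter.Eventually.of_forall fun k => ?_)
  simpa using h k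

theorem sub (h₁ : HasQuadraticApproxAt g₁ p₁ M₁ x) (h₂ : HasQuadraticApproxAt g₂ p₂ M₂ x) :
    HasQuadraticApproxAt (fun z => g₁ z - g₂ z) (p₁ - p₂) (M₁ + M₂) x := fun k => by
  rw [inner_sub_left]
  obtain ⟨hl₁, hu₁⟩ := abs_le.1 (h₁ k)
  obtain ⟨hl₂, hu₂⟩ := abs_le.1 (h₂ k)
  exact abs_le.2 ⟨by linarith, by linarith⟩

theorem const_sub (h : HasQuadraticApproxAt g p M x) (c : ℝ) :
    HasQuadraticApproxAt (fun z => c - g z) (-p) M x := fun k => by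
  rw [inner_neg_left, ← abs_neg]
  convert h k using 2
  ring

theorem sq_norm_le_of_nonneg (h : HasQuadraticApproxAt g p M x) (hM : 0 < M) (hg : ∀ z, 0 ≤ g z) :
    ‖p‖ ^ 2 ≤ 2 * M * g x := by
  have hstep := (abs_le.1 (h (-(M⁻¹ • p)))).2
  rw [inner_neg_right, real_inner_smul_right, real_inner_self_eq_norm_sq, norm_neg, norm_smul,
    Real.norm_of_nonneg (inv_nonneg.2 hM.le)] at hstep
  have hdecrease : ‖p‖ ^ 2 / (2 * M) = M⁻¹ * ‖p‖ ^ 2 - M / 2 * (M⁻¹ * ‖p‖) ^ 2 := by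
    field_simp
    ring
  have : ‖p‖ ^ 2 / (2 * M) ≤ g x := by linarith [hg (x + -(M⁻¹ • p))]
  rwa [div_le_iff₀' (by positivity)] at this

/- Compare `g` at the two points `c ± k` symmetric about the midpoint `c` of `x₁` and `x₂`, using
both approximations, and choose `k` along `p₁ - p₂`. -/
theorem norm_sub_le (h₁ : HasQuadraticApproxAt g p₁ M x₁) (h₂ : HasQuadraticApproxAt g p₂ M x₂)
    (hM : 0 < M) : ‖p₁ - p₂‖ ≤ M * ‖x₁ - x₂‖ := by
  obtain ⟨w, rfl⟩ : ∃ w, x₁ = x₂ + (2 : ℝ) • w := ⟨(2 : ℝ)⁻¹ • (x₁ - x₂), by simp⟩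
  have hinner : ∀ k, inner ℝ (p₁ - p₂) k ≤ M * (‖w‖ ^ 2 + ‖k‖ ^ 2) := fun k => by
    have hplus₁ := (abs_le.1 (h₁ (-w + k))).1
    have hminus₁ := (abs_le.1 (h₁ (-w - k))).2
    have hplus₂ := (abs_le.1 (h₂ (w + k))).2
    have hminus₂ := (abs_le.1 (h₂ (w - k))).1
    rw [show x₂ + (2 : ℝ) • w + (-w + k) = x₂ + (w + k) by module] at hplus₁
    rw [show x₂ + (2 : ℝ) • w + (-w - k) = x₂ + (w - k) by module] at hminus₁
    have hpar₁ := parallelogram_law_with_norm ℝ (-w) k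
    have hpar₂ := parallelogram_law_with_norm ℝ w k
    rw [norm_neg] at hpar₁
    simp only [inner_add_right, inner_sub_right, inner_neg_right, inner_sub_left] at *
    nlinarith
  have hsq := hinner ((2 * M)⁻¹ • (p₁ - p₂))
  rw [real_inner_smul_right, real_inner_self_eq_norm_sq, norm_smul,
    Real.norm_of_nonneg (by positivity)] at hsq
  have hscaled : ‖p₁ - p₂‖ ^ 2 ≤ (2 * M * ‖w‖) ^ 2 := by
    field_simp at hsq
    linarith
  calc ‖p₁ - p₂‖ ≤ 2 * M * ‖w‖ := le_of_sq_le_sq hscaled (by positivity)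
    _ = M * ‖x₂ + (2 : ℝ) • w - x₂‖ := by
        rw [add_sub_cancel_left, norm_smul, Real.norm_ofNat]
        ring

theorem abs_smul_le (h : HasQuadraticApproxAt g p M x) (hu : ‖u‖ = 1) (c : ℝ) :
    |g (x + c • u) - g x - c * inner ℝ p u| ≤ M / 2 * c ^ 2 := by
  simpa [real_inner_smul_right, norm_smul, hu] using h (c • u)

theorem sq_diffQuot_sub_inner_le (h : HasQuadraticApproxAt g p M x) (hu : ‖u‖ = 1) (hm : m ≠ 0) :
    (diffQuot g m x u - inner ℝ p u) ^ 2 ≤ M ^ 2 * m ^ 2 / 4 := by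
  have hquot : diffQuot g m x u - inner ℝ p u =
      (g (x + m • u) - g x - m * inner ℝ p u) / m := by
    rw [diffQuot]
    field_simp
  rw [hquot, div_pow, div_le_iff₀ (by positivity), ← sq_abs]
  calc |g (x + m • u) - g x - m * inner ℝ p u| ^ 2 ≤ (M / 2 * m ^ 2) ^ 2 := by
        gcongr
        exact h.abs_smul_le hu m
    _ = M ^ 2 * m ^ 2 / 4 * m ^ 2 := by ring

theorem add_le_add_diffQuot_smul (h : HasQuadraticApproxAt g p M x) (hu : ‖u‖ = 1) (hm : m ≠ 0)
    {η : ℝ} (hη : 0 ≤ η) (hηM : η * M ≤ 1) :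
    g x + η / 2 * (inner ℝ p u ^ 2 - M ^ 2 * m ^ 2 / 4) ≤ g (x + (η * diffQuot g m x u) • u) := by
  have hstep := (abs_le.1 (h.abs_smul_le hu (η * diffQuot g m x u))).1
  have herr := h.sq_diffQuot_sub_inner_le hu hm
  set s := diffQuot g m x u
  have hcurv : M / 2 * (η * s) ^ 2 ≤ η / 2 * s ^ 2 := by
    calc M / 2 * (η * s) ^ 2 = η / 2 * (η * M * s ^ 2) := by ring
      _ ≤ η / 2 * (1 * s ^ 2) := by gcongr
      _ = η / 2 * s ^ 2 := by rw [one_mul]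
  have hslope : η / 2 * (inner ℝ p u ^ 2 - M ^ 2 * m ^ 2 / 4) ≤
      η * s * inner ℝ p u - η / 2 * s ^ 2 := by
    calc η / 2 * (inner ℝ p u ^ 2 - M ^ 2 * m ^ 2 / 4)
      _ ≤ η / 2 * (inner ℝ p u ^ 2 - (s - inner ℝ p u) ^ 2) := by gcongr
      _ = η * s * inner ℝ p u - η / 2 * s ^ 2 := by ring
  linarith

end HasQuadraticApproxAt

end QuadraticApprox

section Primal

variable {d₁ d₂ : ℕ} {f : EuclideanSpace ℝ (Fin d₁) → EuclideanSpace ℝ (Fin d₂) → ℝ} {l μ : ℝ}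

namespace HasLipschitzGradients

theorem hasQuadraticApproxAt_left (hf : HasLipschitzGradients f l)
    (x : EuclideanSpace ℝ (Fin d₁)) (y : EuclideanSpace ℝ (Fin d₂)) :
    HasQuadraticApproxAt (fun x => f x y) (gradX f x y) l x :=
  hasQuadraticApproxAt_of_lipschitz_gradient
    (hf.differentiable.fun_comp (differentiable_id.prodMk (differentiable_const y)))
    (fun x₁ x₂ => by simpa [gradX] using hf.gradX_le x₁ x₂ y y) x

theorem hasQuadraticApproxAt_right (hf : HasLipschitzGradients f l)
    (x : EuclideanSpace ℝ (Fin d₁)) (y : EuclideanSpace ℝ (Fin d₂)) :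
    HasQuadraticApproxAt (fun y => f x y) (gradY f x y) l y :=
  hasQuadraticApproxAt_of_lipschitz_gradient
    (hf.differentiable.fun_comp ((differentiable_const x).prodMk differentiable_id))
    (fun y₁ y₂ => by simpa [gradY] using hf.gradY_le x x y₁ y₂) y

theorem norm_gradY_add_sub_le (hf : HasLipschitzGradients f l) (x h : EuclideanSpace ℝ (Fin d₁))
    (y : EuclideanSpace ℝ (Fin d₂)) : ‖gradY f (x + h) y - gradY f x y‖ ≤ l * ‖h‖ := by
  simpa using hf.gradY_le (x + h) x y y

theorem sq_norm_gradY_le (hf : HasLipschitzGradients f l) (x h : EuclideanSpace ℝ (Fin d₁))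
    (y : EuclideanSpace ℝ (Fin d₂)) :
    ‖gradY f x y‖ ^ 2 ≤ 2 * ‖gradY f (x + h) y‖ ^ 2 + 2 * l ^ 2 * ‖h‖ ^ 2 := by
  calc ‖gradY f x y‖ ^ 2 ≤ (‖gradY f (x + h) y‖ + l * ‖h‖) ^ 2 := by
        gcongr
        exact (norm_le_norm_add_norm_sub _ _).trans
          (add_le_add_right (hf.norm_gradY_add_sub_le x h y) _)
    _ ≤ 2 * (‖gradY f (x + h) y‖ ^ 2 + (l * ‖h‖) ^ 2) := add_sq_le
    _ = 2 * ‖gradY f (x + h) y‖ ^ 2 + 2 * l ^ 2 * ‖h‖ ^ 2 := by ring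

theorem continuous_gradY (hf : HasLipschitzGradients f l) :
    Continuous fun p : EuclideanSpace ℝ (Fin d₁) × EuclideanSpace ℝ (Fin d₂) =>
      gradY f p.1 p.2 := by
  refine continuous_iff_continuousAt.2 fun q => tendsto_iff_norm_sub_tendsto_zero.2 ?_
  refine squeeze_zero (fun _ => norm_nonneg _) (fun p => hf.gradY_le p.1 q.1 p.2 q.2) ?_
  have : Continuous fun p : EuclideanSpace ℝ (Fin d₁) × EuclideanSpace ℝ (Fin d₂) =>
      l * (‖p.1 - q.1‖ + ‖p.2 - q.2‖) := by fun_prop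
  simpa using this.tendsto q

end HasLipschitzGradients

namespace IsPLInY

theorem le_primalFun (hf : IsPLInY f μ) (x : EuclideanSpace ℝ (Fin d₁))
    (y : EuclideanSpace ℝ (Fin d₂)) : f x y ≤ primalFun f x :=
  let ⟨z, hz⟩ := hf.max_attained x
  le_ciSup ⟨f x z, Set.forall_mem_range.2 hz⟩ y

theorem exists_eq_primalFun (hf : IsPLInY f μ) (x : EuclideanSpace ℝ (Fin d₁)) :
    ∃ y, f x y = primalFun f x :=
  let ⟨z, hz⟩ := hf.max_attained x
  ⟨z, le_antisymm (hf.le_primalFun x z) (ciSup_le hz)⟩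

theorem gradY_eq_zero (hf : IsPLInY f μ) {x : EuclideanSpace ℝ (Fin d₁)}
    {y : EuclideanSpace ℝ (Fin d₂)} (hy : f x y = primalFun f x) : gradY f x y = 0 := by
  have hmax : IsLocalMax (fun y => f x y) y :=
    Filter.Eventually.of_forall fun z => (hf.le_primalFun x z).trans_eq hy.symm
  rw [gradY, gradient, hmax.fderiv_eq_zero, map_zero]

end IsPLInY

/- At a maximizer `y` of `f x`, `Φ(x + h)` lies above `f (x + h) y` by at most
`‖∇_y f(x + h, y)‖ ^ 2 / (2 * μ)`, and `∇_y f(x, y) = 0` makes this quadratic in `h`. -/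
theorem hasQuadraticApproxAt_primalFun_of_eq (hf : HasLipschitzGradients f l)
    (hPL : IsPLInY f μ) (hμ : 0 < μ) {x : EuclideanSpace ℝ (Fin d₁)}
    {y : EuclideanSpace ℝ (Fin d₂)} (hy : f x y = primalFun f x) :
    HasQuadraticApproxAt (primalFun f) (gradX f x y) (l + l ^ 2 / μ) x := by
  intro h
  obtain ⟨hlower, hupper⟩ := abs_le.1 (hf.hasQuadraticApproxAt_left x y h)
  have hnonneg : 0 ≤ primalFun f (x + h) - f (x + h) y := sub_nonneg.2 (hPL.le_primalFun _ _)
  have hgap : primalFun f (x + h) - f (x + h) y ≤ l ^ 2 / μ / 2 * ‖h‖ ^ 2 := by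
    calc primalFun f (x + h) - f (x + h) y ≤ ‖gradY f (x + h) y‖ ^ 2 / (2 * μ) :=
          (le_div_iff₀' (by positivity)).2 (hPL.pl _ _)
      _ ≤ (l * ‖h‖) ^ 2 / (2 * μ) := by
          gcongr
          simpa [hPL.gradY_eq_zero hy] using hf.norm_gradY_add_sub_le x h y
      _ = l ^ 2 / μ / 2 * ‖h‖ ^ 2 := by field_simp
  rw [← hy, add_div, add_mul, abs_le]
  constructor <;> linarith

theorem hasQuadraticApproxAt_primalFun (hf : HasLipschitzGradients f l) (hPL : IsPLInY f μ)
    (hμ : 0 < μ) (x : EuclideanSpace ℝ (Fin d₁)) :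
    HasQuadraticApproxAt (primalFun f) (gradient (primalFun f) x) (l + l ^ 2 / μ) x := by
  obtain ⟨y, hy⟩ := hPL.exists_eq_primalFun x
  have h := hasQuadraticApproxAt_primalFun_of_eq hf hPL hμ hy
  rwa [h.hasGradientAt.gradient]

theorem differentiable_primalFun (hf : HasLipschitzGradients f l) (hPL : IsPLInY f μ)
    (hμ : 0 < μ) : Differentiable ℝ (primalFun f) := fun x =>
  (hasQuadraticApproxAt_primalFun hf hPL hμ x).hasGradientAt.differentiableAt

theorem continuous_gradient_primalFun (hf : HasLipschitzGradients f l) (hPL : IsPLInY f μ)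
    (hμ : 0 < μ) (hl : 0 < l) : Continuous (gradient (primalFun f)) := by
  refine (LipschitzWith.of_dist_le' (K := l + l ^ 2 / μ) fun x₁ x₂ => ?_).continuous
  rw [dist_eq_norm, dist_eq_norm]
  exact (hasQuadraticApproxAt_primalFun hf hPL hμ x₁).norm_sub_le
    (hasQuadraticApproxAt_primalFun hf hPL hμ x₂) (by positivity)

/- `Φ(x) - f(x, y) ≥ 0` is smooth in `x` and in `y`, so it bounds the squares of both its partial
gradients `∇Φ - ∇_x f` and `-∇_y f`; the Polyak-Łojasiewicz inequality bounds it by the latter. -/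
theorem sq_norm_gradX_sub_gradient_primalFun_le (hf : HasLipschitzGradients f l)
    (hPL : IsPLInY f μ) (hμ : 0 < μ) (hl : 0 < l) (x : EuclideanSpace ℝ (Fin d₁))
    (y : EuclideanSpace ℝ (Fin d₂)) :
    ‖gradX f x y - gradient (primalFun f) x‖ ^ 2 ≤ 3 * (l / μ) ^ 2 * ‖gradY f x y‖ ^ 2 := by
  have hX : ‖gradient (primalFun f) x - gradX f x y‖ ^ 2 ≤
      2 * (l + l ^ 2 / μ + l) * (primalFun f x - f x y) :=
    ((hasQuadraticApproxAt_primalFun hf hPL hμ x).sub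
      (hf.hasQuadraticApproxAt_left x y)).sq_norm_le_of_nonneg (by positivity)
      fun z => sub_nonneg.2 (hPL.le_primalFun z y)
  have hY : ‖gradY f x y‖ ^ 2 ≤ 2 * l * (primalFun f x - f x y) := by
    simpa using ((hf.hasQuadraticApproxAt_right x y).const_sub
      (primalFun f x)).sq_norm_le_of_nonneg hl fun z => sub_nonneg.2 (hPL.le_primalFun x z)
  have hgap := hPL.pl x y
  rw [norm_sub_rev]
  set N := ‖gradY f x y‖ ^ 2
  set gap := primalFun f x - f x y
  have hN : μ * N ≤ l * N := by
    calc μ * N ≤ μ * (2 * l * gap) := by gcongr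
      _ = l * (2 * μ * gap) := by ring
      _ ≤ l * N := by gcongr
  calc ‖gradient (primalFun f) x - gradX f x y‖ ^ 2 ≤ 2 * (l + l ^ 2 / μ + l) * gap := hX
    _ = (2 * l * μ + l ^ 2) / μ ^ 2 * (2 * μ * gap) := by
        field_simp
        ring
    _ ≤ (2 * l * μ + l ^ 2) / μ ^ 2 * N := by gcongr
    _ = (2 * l * (μ * N) + l ^ 2 * N) / μ ^ 2 := by ring
    _ ≤ (2 * l * (l * N) + l ^ 2 * N) / μ ^ 2 := by gcongr
    _ = 3 * (l / μ) ^ 2 * N := by ring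

end Primal

section Steps

variable {d₁ d₂ : ℕ} {f : EuclideanSpace ℝ (Fin d₁) → EuclideanSpace ℝ (Fin d₂) → ℝ}
  {l μ α β m : ℝ}

/-- One zeroth-order descent step in `x` from `p = (x, y)` along the direction `u`. -/
noncomputable def descentStep (f : EuclideanSpace ℝ (Fin d₁) → EuclideanSpace ℝ (Fin d₂) → ℝ)
    (α m : ℝ) (p : EuclideanSpace ℝ (Fin d₁) × EuclideanSpace ℝ (Fin d₂))
    (u : EuclideanSpace ℝ (Fin d₁)) : EuclideanSpace ℝ (Fin d₁) × EuclideanSpace ℝ (Fin d₂) :=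
  (p.1 - α • zoGradX f m p.1 p.2 u, p.2)

/-- One zeroth-order ascent step in `y` from `p = (x, y)` along the direction `v`. -/
noncomputable def ascentStep (f : EuclideanSpace ℝ (Fin d₁) → EuclideanSpace ℝ (Fin d₂) → ℝ)
    (β m : ℝ) (p : EuclideanSpace ℝ (Fin d₁) × EuclideanSpace ℝ (Fin d₂))
    (v : EuclideanSpace ℝ (Fin d₂)) : EuclideanSpace ℝ (Fin d₁) × EuclideanSpace ℝ (Fin d₂) :=
  (p.1, p.2 + β • zoGradY f m p.1 p.2 v)

/-- The Lyapunov function `2 * Φ(x) + (Φ(x) - f(x, y))` of the iteration. -/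
noncomputable def potential (f : EuclideanSpace ℝ (Fin d₁) → EuclideanSpace ℝ (Fin d₂) → ℝ)
    (p : EuclideanSpace ℝ (Fin d₁) × EuclideanSpace ℝ (Fin d₂)) : ℝ :=
  3 * primalFun f p.1 - f p.1 p.2

/-- The value to which an ascent step in `y` with step size `β` brings down the potential on
average, up to the error of the difference quotients. -/
noncomputable def ascendedPotential
    (f : EuclideanSpace ℝ (Fin d₁) → EuclideanSpace ℝ (Fin d₂) → ℝ) (β : ℝ)
    (p : EuclideanSpace ℝ (Fin d₁) × EuclideanSpace ℝ (Fin d₂)) : ℝ :=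
  potential f p - β / 2 * ‖gradY f p.1 p.2‖ ^ 2

theorem descentStep_eq (p : EuclideanSpace ℝ (Fin d₁) × EuclideanSpace ℝ (Fin d₂))
    (u : EuclideanSpace ℝ (Fin d₁)) :
    descentStep f α m p u =
      (p.1 + (-(α * d₁ * diffQuot (fun x => f x p.2) m p.1 u)) • u, p.2) := by
  rw [descentStep, zoGradX, div_div_eq_mul_div, mul_div_right_comm, mul_comm, smul_smul,
    ← mul_assoc, neg_smul, ← sub_eq_add_neg, diffQuot]

theorem ascentStep_eq (p : EuclideanSpace ℝ (Fin d₁) × EuclideanSpace ℝ (Fin d₂))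
    (v : EuclideanSpace ℝ (Fin d₂)) :
    ascentStep f β m p v = (p.1, p.2 + (β * d₂ * diffQuot (f p.1) m p.2 v) • v) := by
  rw [ascentStep, zoGradY, div_div_eq_mul_div, mul_div_right_comm, mul_comm, smul_smul,
    ← mul_assoc, diffQuot]

theorem continuous_descentStep (hf : HasLipschitzGradients f l) (α m : ℝ) :
    Continuous (Function.uncurry (descentStep f α m)) := by
  have := hf.differentiable.continuous
  unfold Function.uncurry descentStep zoGradX
  fun_prop

theorem continuous_ascentStep (hf : HasLipschitzGradients f l) (β m : ℝ) :
    Continuous (Function.uncurry (ascentStep f β m)) := by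
  have := hf.differentiable.continuous
  unfold Function.uncurry ascentStep zoGradY
  fun_prop

theorem continuous_potential (hf : HasLipschitzGradients f l) (hPL : IsPLInY f μ) (hμ : 0 < μ) :
    Continuous (potential f) :=
  (((differentiable_primalFun hf hPL hμ).continuous.comp continuous_fst).const_mul 3).sub
    hf.differentiable.continuous

theorem continuous_ascendedPotential (hf : HasLipschitzGradients f l) (hPL : IsPLInY f μ)
    (hμ : 0 < μ) (β : ℝ) : Continuous (ascendedPotential f β) :=
  (continuous_potential hf hPL hμ).sub ((hf.continuous_gradY.norm.pow 2).const_mul (β / 2))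

theorem potential_ascentStep_le (hf : HasLipschitzGradients f l) (hm : m ≠ 0) (hβ : 0 ≤ β)
    (hβl : β * d₂ * l ≤ 1) (p : EuclideanSpace ℝ (Fin d₁) × EuclideanSpace ℝ (Fin d₂))
    {v : EuclideanSpace ℝ (Fin d₂)} (hv : ‖v‖ = 1) :
    potential f (ascentStep f β m p v) ≤
      potential f p - β * d₂ / 2 * (inner ℝ (gradY f p.1 p.2) v ^ 2 - l ^ 2 * m ^ 2 / 4) := by
  have := (hf.hasQuadraticApproxAt_right p.1 p.2).add_le_add_diffQuot_smul hv hm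
    (by positivity) hβl
  simp only [ascentStep_eq, potential]
  linarith

theorem integral_potential_ascentStep_le [NeZero d₂] (hf : HasLipschitzGradients f l)
    (hPL : IsPLInY f μ) (hμ : 0 < μ) (hm : m ≠ 0) (hβ : 0 ≤ β) (hβl : β * d₂ * l ≤ 1)
    (p : EuclideanSpace ℝ (Fin d₁) × EuclideanSpace ℝ (Fin d₂)) :
    ∫ v, potential f (ascentStep f β m p v) ∂(uniformSphere d₂) ≤
      ascendedPotential f β p + β * d₂ * l ^ 2 * m ^ 2 / 8 := by
  have hcont : Continuous fun v => potential f (ascentStep f β m p v) :=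
    (continuous_potential hf hPL hμ).comp ((continuous_ascentStep hf β m).comp (.prodMk_right p))
  calc ∫ v, potential f (ascentStep f β m p v) ∂(uniformSphere d₂)
    _ ≤ potential f p + β * d₂ * l ^ 2 * m ^ 2 / 8 +
          (-(β / 2) * ‖gradY f p.1 p.2‖ ^ 2 + 0 * ‖(0 : EuclideanSpace ℝ (Fin d₂))‖ ^ 2) :=
        integral_uniformSphere_le_of_le_inner_sq hcont fun v hv => by
          linarith [potential_ascentStep_le hf hm hβ hβl p hv]
    _ = ascendedPotential f β p + β * d₂ * l ^ 2 * m ^ 2 / 8 := by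
        rw [ascendedPotential]
        ring

/- With `s = A + D + r` the difference of the two sides is
`(A + r) ^ 2 / 2 + (D - 2 * r) ^ 2 / 2 + r ^ 2`. -/
theorem mul_sub_add_sq_div_two_le (s A D : ℝ) :
    s * (D - 2 * A) + s ^ 2 / 2 ≤ 2 * D ^ 2 - A ^ 2 + 4 * (s - A - D) ^ 2 := by
  nlinarith [sq_nonneg (s - D), sq_nonneg (D - 2 * (s - A - D)), sq_nonneg (s - A - D)]

theorem ascendedPotential_descentStep_le (hf : HasLipschitzGradients f l) (hPL : IsPLInY f μ)
    (hμ : 0 < μ) (hm : m ≠ 0) (hα : 0 ≤ α) (hβ : 0 ≤ β)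
    (hαl : α * d₁ * (3 * (l + l ^ 2 / μ) + l + β * l ^ 2) ≤ 1)
    (p : EuclideanSpace ℝ (Fin d₁) × EuclideanSpace ℝ (Fin d₂))
    {u : EuclideanSpace ℝ (Fin d₁)} (hu : ‖u‖ = 1) :
    ascendedPotential f β (descentStep f α m p u) ≤
      potential f p - β / 4 * ‖gradY f p.1 p.2‖ ^ 2 + α * d₁ * l ^ 2 * m ^ 2 + α * d₁ *
        (2 * inner ℝ (gradX f p.1 p.2 - gradient (primalFun f) p.1) u ^ 2 -
          inner ℝ (gradient (primalFun f) p.1) u ^ 2) := by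
  have hΦ := hasQuadraticApproxAt_primalFun hf hPL hμ p.1
  have hfX := hf.hasQuadraticApproxAt_left p.1 p.2
  set A : ℝ := inner ℝ (gradient (primalFun f) p.1) u
  set D : ℝ := inner ℝ (gradX f p.1 p.2 - gradient (primalFun f) p.1) u with hD
  set s := diffQuot (fun x => f x p.2) m p.1 u with hs
  have hAD : inner ℝ (gradX f p.1 p.2) u = A + D := by
    rw [hD, inner_sub_left]
    ring
  set η := α * d₁
  have herr : (s - A - D) ^ 2 ≤ l ^ 2 * m ^ 2 / 4 := by
    have := hfX.sq_diffQuot_sub_inner_le hu hm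
    rwa [hAD, ← hs, ← sub_sub] at this
  have hΦstep := (abs_le.1 (hΦ.abs_smul_le hu (-(η * s)))).2
  have hfstep := (abs_le.1 (hfX.abs_smul_le hu (-(η * s)))).1
  have hgradY := hf.sq_norm_gradY_le p.1 ((-(η * s)) • u) p.2
  rw [norm_smul, hu, mul_one, Real.norm_eq_abs, sq_abs] at hgradY
  rw [hAD] at hfstep
  have hcurv : η * (3 * (l + l ^ 2 / μ) + l + β * l ^ 2) * (η * s ^ 2 / 2) ≤
      1 * (η * s ^ 2 / 2) := by gcongr
  have hquad : η * (s * (D - 2 * A) + s ^ 2 / 2) ≤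
      η * (2 * D ^ 2 - A ^ 2 + 4 * (l ^ 2 * m ^ 2 / 4)) := by
    refine mul_le_mul_of_nonneg_left ?_ (by positivity)
    linarith [mul_sub_add_sq_div_two_le s A D]
  have hgradY' := mul_le_mul_of_nonneg_left hgradY (by positivity : 0 ≤ β / 4)
  simp only [descentStep_eq, ascendedPotential, potential]
  linarith

theorem integral_ascendedPotential_descentStep_le [NeZero d₁] (hf : HasLipschitzGradients f l)
    (hPL : IsPLInY f μ) (hl : 0 < l) (hμ : 0 < μ) (hm : m ≠ 0) (hα : 0 ≤ α) (hβ : 0 ≤ β)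
    (hαl : α * d₁ * (3 * (l + l ^ 2 / μ) + l + β * l ^ 2) ≤ 1) (hαβ : 24 * (l / μ) ^ 2 * α ≤ β)
    (p : EuclideanSpace ℝ (Fin d₁) × EuclideanSpace ℝ (Fin d₂)) :
    ∫ u, ascendedPotential f β (descentStep f α m p u) ∂(uniformSphere d₁) ≤
      potential f p - α * ‖gradient (primalFun f) p.1‖ ^ 2 + α * d₁ * l ^ 2 * m ^ 2 := by
  have hcont : Continuous fun u => ascendedPotential f β (descentStep f α m p u) :=
    (continuous_ascendedPotential hf hPL hμ β).comp
      ((continuous_descentStep hf α m).comp (.prodMk_right p))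
  have hproxy : 2 * α * ‖gradX f p.1 p.2 - gradient (primalFun f) p.1‖ ^ 2 ≤
      β / 4 * ‖gradY f p.1 p.2‖ ^ 2 := by
    calc 2 * α * ‖gradX f p.1 p.2 - gradient (primalFun f) p.1‖ ^ 2
      _ ≤ 2 * α * (3 * (l / μ) ^ 2 * ‖gradY f p.1 p.2‖ ^ 2) := by
          gcongr
          exact sq_norm_gradX_sub_gradient_primalFun_le hf hPL hμ hl p.1 p.2
      _ = 24 * (l / μ) ^ 2 * α * ‖gradY f p.1 p.2‖ ^ 2 / 4 := by ring
      _ ≤ β * ‖gradY f p.1 p.2‖ ^ 2 / 4 := by gcongr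
      _ = β / 4 * ‖gradY f p.1 p.2‖ ^ 2 := by ring
  calc _ ≤ potential f p - β / 4 * ‖gradY f p.1 p.2‖ ^ 2 + α * d₁ * l ^ 2 * m ^ 2 +
        (2 * α * ‖gradX f p.1 p.2 - gradient (primalFun f) p.1‖ ^ 2 +
          -α * ‖gradient (primalFun f) p.1‖ ^ 2) :=
        integral_uniformSphere_le_of_le_inner_sq hcont fun u hu => by
          linarith [ascendedPotential_descentStep_le hf hPL hμ hm hα hβ hαl p hu]
    _ ≤ potential f p - α * ‖gradient (primalFun f) p.1‖ ^ 2 + α * d₁ * l ^ 2 * m ^ 2 := by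
        linarith

end Steps

section Randomness

variable {Ω A B C : Type*} [MeasurableSpace Ω] {P : Measure Ω}

/-- The random variable `Z` stays almost surely in a compact set, so that continuous functions
of it are integrable. -/
def AEMemCompact [TopologicalSpace A] (Z : Ω → A) (P : Measure Ω) : Prop :=
  ∃ K, IsCompact K ∧ ∀ᵐ ω ∂P, Z ω ∈ K

namespace AEMemCompact

variable [TopologicalSpace A] [TopologicalSpace B] {Z : Ω → A} {U : Ω → B}

theorem const (a : A) : AEMemCompact (fun _ => a) P :=
  ⟨{a}, isCompact_singleton, by simp⟩

theorem prodMk (hZ : AEMemCompact Z P) (hU : AEMemCompact U P) :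
    AEMemCompact (fun ω => (Z ω, U ω)) P :=
  let ⟨K, hK, hZK⟩ := hZ
  let ⟨K', hK', hUK'⟩ := hU
  ⟨K ×ˢ K', hK.prod hK', hZK.mp (hUK'.mono fun _ hU hZ => ⟨hZ, hU⟩)⟩

theorem comp {F : A → B} (hF : Continuous F) (hZ : AEMemCompact Z P) :
    AEMemCompact (fun ω => F (Z ω)) P :=
  let ⟨K, hK, hZK⟩ := hZ
  ⟨F '' K, hK.image hF, hZK.mono fun _ => Set.mem_image_of_mem F⟩

theorem integrable_comp [MeasurableSpace A] [OpensMeasurableSpace A] [IsFiniteMeasure P]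
    (hZ : AEMemCompact Z P) (hZm : Measurable Z) {F : A → ℝ} (hF : Continuous F) :
    Integrable (fun ω => F (Z ω)) P := by
  obtain ⟨K, hK, hZK⟩ := hZ
  obtain ⟨c, hc⟩ := hK.exists_bound_of_continuousOn hF.continuousOn
  exact .of_bound (hF.measurable.comp hZm).aestronglyMeasurable c (hZK.mono fun ω => hc (Z ω))

end AEMemCompact

theorem aeMemCompact_of_map_eq_uniformSphere {d : ℕ} {U : Ω → EuclideanSpace ℝ (Fin d)}
    (hU : Measurable U) (hUlaw : P.map U = uniformSphere d) : AEMemCompact U P := by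
  refine ⟨Metric.sphere 0 1, isCompact_sphere _ _, ?_⟩
  simp only [mem_sphere_zero_iff_norm]
  exact ae_of_ae_map hU.aemeasurable (hUlaw ▸ ae_norm_eq_one_uniformSphere)

/-- `u 0, u 1, …` are independent random vectors, each uniformly distributed on the unit sphere. -/
structure IsUniformDirections {d : ℕ} (u : ℕ → Ω → EuclideanSpace ℝ (Fin d)) (P : Measure Ω) :
    Prop where
  measurable : ∀ t, Measurable (u t)
  map_eq : ∀ t, P.map (u t) = uniformSphere d
  iIndepFun : iIndepFun u P

theorem IsUniformDirections.aeMemCompact {d : ℕ} {u : ℕ → Ω → EuclideanSpace ℝ (Fin d)}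
    (hu : IsUniformDirections u P) (t : ℕ) : AEMemCompact (u t) P :=
  aeMemCompact_of_map_eq_uniformSphere (hu.measurable t) (hu.map_eq t)

variable [IsProbabilityMeasure P] [MeasurableSpace A] [MeasurableSpace B] [MeasurableSpace C]

theorem integral_le_of_forall_integral_uniformSphere_le [TopologicalSpace A]
    [SecondCountableTopology A] [OpensMeasurableSpace A] {d : ℕ} {Z : Ω → A}
    {U : Ω → EuclideanSpace ℝ (Fin d)} (hZ : Measurable Z) (hZK : AEMemCompact Z P)
    (hU : Measurable U) (hUlaw : P.map U = uniformSphere d) (hUZ : IndepFun U Z P)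
    {F : A → EuclideanSpace ℝ (Fin d) → ℝ} (hF : Continuous (Function.uncurry F)) {G : A → ℝ}
    (hG : Continuous G) (hFG : ∀ z, ∫ w, F z w ∂(uniformSphere d) ≤ G z) :
    ∫ ω, F (Z ω) (U ω) ∂P ≤ ∫ ω, G (Z ω) ∂P := by
  have hZU : Measurable fun ω => (Z ω, U ω) := hZ.prodMk hU
  have hFm := hF.measurable.aestronglyMeasurable (μ := (P.map Z).prod (P.map U))
  have := Measure.isProbabilityMeasure_map (μ := P) hZ.aemeasurable
  have := Measure.isProbabilityMeasure_map (μ := P) hU.aemeasurable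
  have hlaw : P.map (fun ω => (Z ω, U ω)) = (P.map Z).prod (P.map U) :=
    (indepFun_iff_map_prod_eq_prod_map_map hZ.aemeasurable hU.aemeasurable).1 hUZ.symm
  have hFint : Integrable (Function.uncurry F) ((P.map Z).prod (P.map U)) := by
    rw [← hlaw, integrable_map_measure (hlaw ▸ hFm) hZU.aemeasurable]
    exact (hZK.prodMk (aeMemCompact_of_map_eq_uniformSphere hU hUlaw)).integrable_comp hZU hF
  calc ∫ ω, F (Z ω) (U ω) ∂P
    _ = ∫ q, Function.uncurry F q ∂((P.map Z).prod (P.map U)) := by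
        rw [← hlaw, integral_map hZU.aemeasurable (hlaw ▸ hFm)]
        rfl
    _ = ∫ z, ∫ w, F z w ∂(uniformSphere d) ∂(P.map Z) := by
        rw [integral_prod _ hFint, hUlaw]
        rfl
    _ ≤ ∫ z, G z ∂(P.map Z) := by
        refine integral_mono ?_ ?_ hFG
        · simpa only [hUlaw, Function.uncurry_apply_pair] using hFint.integral_prod_left
        · exact (integrable_map_measure hG.measurable.aestronglyMeasurable hZ.aemeasurable).2
            (hZK.integrable_comp hZ hG)
    _ = ∫ ω, G (Z ω) ∂P :=
        integral_map hZ.aemeasurable hG.measurable.aestronglyMeasurable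

theorem sq_integral_le_integral_sq {X : Ω → ℝ} (hX : Integrable X P)
    (hX2 : Integrable (fun ω => X ω ^ 2) P) : (∫ ω, X ω ∂P) ^ 2 ≤ ∫ ω, X ω ^ 2 ∂P :=
  (even_two.convexOn_pow).map_integral_le (continuous_pow 2).continuousOn isClosed_univ
    (by simp) hX hX2

theorem indepFun_prodMk_of_indepFun {X : Ω → A} {Y : Ω → B} {W : Ω → C} (hX : Measurable X)
    (hY : Measurable Y) (hW : Measurable W) (hXY : IndepFun X Y P)
    (h : IndepFun (fun ω => (X ω, Y ω)) W P) : IndepFun X (fun ω => (Y ω, W ω)) P := by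
  have hYW : IndepFun Y W P := h.comp measurable_snd measurable_id
  have := Measure.isProbabilityMeasure_map (μ := P) hX.aemeasurable
  have := Measure.isProbabilityMeasure_map (μ := P) hY.aemeasurable
  have := Measure.isProbabilityMeasure_map (μ := P) hW.aemeasurable
  rw [indepFun_iff_map_prod_eq_prod_map_map (by fun_prop) (by fun_prop)] at hXY hYW h ⊢
  rw [hYW, ← Measure.prodAssoc_prod, ← hXY, ← h, Measure.map_map (by fun_prop) (by fun_prop)]
  rfl

theorem IsUniformDirections.indepFun_of_measurable {d : ℕ}
    {u : ℕ → Ω → EuclideanSpace ℝ (Fin d)} (hu : IsUniformDirections u P)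
    {W : Ω → B} (hW : Measurable W) (huW : IndepFun (fun ω t => u t ω) W P) {t : ℕ} {Z : Ω → C}
    (hZ : ∀ m : MeasurableSpace Ω, (∀ s < t, Measurable[m] (u s)) → Measurable[m] W →
      Measurable[m] Z) : IndepFun (u t) Z P := by
  let past : Ω → (Finset.range t → EuclideanSpace ℝ (Fin d)) × B :=
    fun ω => (fun s => u s ω, W ω)
  have hmeas : Measurable fun ω (s : Finset.range t) => u s ω :=
    measurable_pi_lambda _ fun s => hu.measurable s
  have hpast : IndepFun (u t) past P := by
    refine indepFun_prodMk_of_indepFun (hu.measurable t) hmeas hW ?_ ?_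
    · exact (hu.iIndepFun.indepFun_finset {t} (Finset.range t) (by simp) hu.measurable).comp
        (measurable_pi_apply ⟨t, Finset.mem_singleton_self t⟩) measurable_id
    · exact huW.comp (φ := fun w => (w t, fun s : Finset.range t => w s)) (by fun_prop)
        measurable_id
  have hpast_meas : Measurable[.comap past inferInstance] past := comap_measurable past
  refine indep_of_indep_of_le_right hpast (hZ (.comap past inferInstance) (fun s hs => ?_)
    (measurable_snd.comp hpast_meas)).comap_le
  exact ((measurable_pi_apply ⟨s, Finset.mem_range.2 hs⟩).comp measurable_fst).comp hpast_meas

end Randomness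

section Iterates

variable {d₁ d₂ : ℕ} {f : EuclideanSpace ℝ (Fin d₁) → EuclideanSpace ℝ (Fin d₂) → ℝ}
  {l μ α β μ₁ μ₂ : ℝ} {x₀ : EuclideanSpace ℝ (Fin d₁)} {y₀ : EuclideanSpace ℝ (Fin d₂)}
  {Ω : Type*}

theorem measurable_descentStep {_ : MeasurableSpace Ω} (hf : HasLipschitzGradients f l)
    {Z : Ω → EuclideanSpace ℝ (Fin d₁) × EuclideanSpace ℝ (Fin d₂)}
    {U : Ω → EuclideanSpace ℝ (Fin d₁)} (hZ : Measurable Z) (hU : Measurable U) :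
    Measurable fun ω => descentStep f α μ₁ (Z ω) (U ω) :=
  (continuous_descentStep hf α μ₁).measurable.comp (hZ.prodMk hU)

theorem measurable_ascentStep {_ : MeasurableSpace Ω} (hf : HasLipschitzGradients f l)
    {Z : Ω → EuclideanSpace ℝ (Fin d₁) × EuclideanSpace ℝ (Fin d₂)}
    {V : Ω → EuclideanSpace ℝ (Fin d₂)} (hZ : Measurable Z) (hV : Measurable V) :
    Measurable fun ω => ascentStep f β μ₂ (Z ω) (V ω) :=
  (continuous_ascentStep hf β μ₂).measurable.comp (hZ.prodMk hV)

theorem measurable_zoAGDA {_ : MeasurableSpace Ω} (hf : HasLipschitzGradients f l)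
    {u : ℕ → Ω → EuclideanSpace ℝ (Fin d₁)} {v : ℕ → Ω → EuclideanSpace ℝ (Fin d₂)} {t : ℕ}
    (hu : ∀ s < t, Measurable (u s)) (hv : ∀ s < t, Measurable (v s)) :
    Measurable fun ω => zoAGDA f α β μ₁ μ₂ x₀ y₀ (fun s => u s ω) (fun s => v s ω) t := by
  induction t with
  | zero => exact measurable_const
  | succ t ih =>
    have hZ := ih (fun s hs => hu s (hs.trans t.lt_succ_self))
      fun s hs => hv s (hs.trans t.lt_succ_self)
    exact measurable_ascentStep hf (measurable_descentStep hf hZ (hu t t.lt_succ_self))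
      (hv t t.lt_succ_self)

variable [MeasurableSpace Ω] {P : Measure Ω}

theorem aeMemCompact_descentStep (hf : HasLipschitzGradients f l)
    {Z : Ω → EuclideanSpace ℝ (Fin d₁) × EuclideanSpace ℝ (Fin d₂)}
    {U : Ω → EuclideanSpace ℝ (Fin d₁)} (hZ : AEMemCompact Z P) (hU : AEMemCompact U P) :
    AEMemCompact (fun ω => descentStep f α μ₁ (Z ω) (U ω)) P :=
  (hZ.prodMk hU).comp (continuous_descentStep hf α μ₁)

theorem aeMemCompact_zoAGDA (hf : HasLipschitzGradients f l)
    {u : ℕ → Ω → EuclideanSpace ℝ (Fin d₁)} {v : ℕ → Ω → EuclideanSpace ℝ (Fin d₂)}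
    (hu : ∀ t, AEMemCompact (u t) P) (hv : ∀ t, AEMemCompact (v t) P) (t : ℕ) :
    AEMemCompact (fun ω => zoAGDA f α β μ₁ μ₂ x₀ y₀ (fun s => u s ω) (fun s => v s ω) t) P := by
  induction t with
  | zero => exact .const _
  | succ t ih =>
    exact ((aeMemCompact_descentStep hf ih (hu t)).prodMk (hv t)).comp
      (continuous_ascentStep hf β μ₂)

/-- The step sizes `α`, `β` and smoothing radii `μ₁`, `μ₂` bring the iteration to accuracy `ε`:
each step is short enough for a decrease of the potential, `x` moves on a slower time scale than
`y`, and the errors of the difference quotients cost at most three quarters of `α * ε ^ 2` per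
iteration. -/
structure IsAdmissible (d₁ d₂ : ℕ) (l μ α β μ₁ μ₂ ε : ℝ) : Prop where
  α_pos : 0 < α
  β_pos : 0 < β
  ε_pos : 0 < ε
  μ₁_ne_zero : μ₁ ≠ 0
  μ₂_ne_zero : μ₂ ≠ 0
  descent_le : α * d₁ * (3 * (l + l ^ 2 / μ) + l + β * l ^ 2) ≤ 1
  ascent_le : β * d₂ * l ≤ 1
  timescale_le : 24 * (l / μ) ^ 2 * α ≤ β
  noise_le : α * d₁ * l ^ 2 * μ₁ ^ 2 + β * d₂ * l ^ 2 * μ₂ ^ 2 / 8 ≤ 3 / 4 * (α * ε ^ 2)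

variable [IsProbabilityMeasure P] {ε : ℝ}

theorem integral_potential_ascentStep_descentStep_le [NeZero d₁] [NeZero d₂]
    (hf : HasLipschitzGradients f l) (hPL : IsPLInY f μ) (hl : 0 < l) (hμ : 0 < μ)
    (h : IsAdmissible d₁ d₂ l μ α β μ₁ μ₂ ε)
    {Z : Ω → EuclideanSpace ℝ (Fin d₁) × EuclideanSpace ℝ (Fin d₂)}
    {U : Ω → EuclideanSpace ℝ (Fin d₁)} {V : Ω → EuclideanSpace ℝ (Fin d₂)}
    (hZ : Measurable Z) (hU : Measurable U) (hV : Measurable V) (hZK : AEMemCompact Z P)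
    (hUlaw : P.map U = uniformSphere d₁) (hVlaw : P.map V = uniformSphere d₂)
    (hUZ : IndepFun U Z P) (hVZ : IndepFun V (fun ω => descentStep f α μ₁ (Z ω) (U ω)) P) :
    ∫ ω, potential f (ascentStep f β μ₂ (descentStep f α μ₁ (Z ω) (U ω)) (V ω)) ∂P ≤
      ∫ ω, potential f (Z ω) ∂P - α * ∫ ω, ‖gradient (primalFun f) (Z ω).1‖ ^ 2 ∂P +
        3 / 4 * (α * ε ^ 2) := by
  have hW : Measurable fun ω => descentStep f α μ₁ (Z ω) (U ω) := measurable_descentStep hf hZ hU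
  have hWK : AEMemCompact (fun ω => descentStep f α μ₁ (Z ω) (U ω)) P :=
    aeMemCompact_descentStep hf hZK (aeMemCompact_of_map_eq_uniformSphere hU hUlaw)
  have hpot := continuous_potential hf hPL hμ
  have hasc := continuous_ascendedPotential hf hPL hμ β
  have hgrad : Continuous fun p : EuclideanSpace ℝ (Fin d₁) × EuclideanSpace ℝ (Fin d₂) =>
      α * ‖gradient (primalFun f) p.1‖ ^ 2 :=
    (((continuous_gradient_primalFun hf hPL hμ hl).comp continuous_fst).norm.pow 2).const_mul α
  have hdecr : Continuous fun p => potential f p - α * ‖gradient (primalFun f) p.1‖ ^ 2 :=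
    hpot.sub hgrad
  have hascent := integral_le_of_forall_integral_uniformSphere_le hW hWK hV hVlaw hVZ
    (F := fun p v => potential f (ascentStep f β μ₂ p v))
    (G := fun p => ascendedPotential f β p + β * d₂ * l ^ 2 * μ₂ ^ 2 / 8)
    (hpot.comp (continuous_ascentStep hf β μ₂)) (hasc.add continuous_const)
    (integral_potential_ascentStep_le hf hPL hμ h.μ₂_ne_zero h.β_pos.le h.ascent_le)
  have hdescent := integral_le_of_forall_integral_uniformSphere_le hZ hZK hU hUlaw hUZ
    (F := fun p u => ascendedPotential f β (descentStep f α μ₁ p u))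
    (G := fun p => potential f p - α * ‖gradient (primalFun f) p.1‖ ^ 2 + α * d₁ * l ^ 2 * μ₁ ^ 2)
    (hasc.comp (continuous_descentStep hf α μ₁)) (hdecr.add continuous_const)
    (integral_ascendedPotential_descentStep_le hf hPL hl hμ h.μ₁_ne_zero h.α_pos.le h.β_pos.le
      h.descent_le h.timescale_le)
  rw [integral_add (hWK.integrable_comp hW hasc) (integrable_const _), integral_const,
    probReal_univ, one_smul] at hascent
  rw [integral_add (hZK.integrable_comp hZ hdecr) (integrable_const _),
    integral_sub (hZK.integrable_comp hZ hpot) (hZK.integrable_comp hZ hgrad),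
    integral_const_mul, integral_const, probReal_univ, one_smul] at hdescent
  linarith [h.noise_le]

theorem indepFun_fst_zoAGDA (hf : HasLipschitzGradients f l)
    {u : ℕ → Ω → EuclideanSpace ℝ (Fin d₁)} {v : ℕ → Ω → EuclideanSpace ℝ (Fin d₂)}
    (hu : IsUniformDirections u P) (hv : ∀ t, Measurable (v t))
    (huv : IndepFun (fun ω t => u t ω) (fun ω t => v t ω) P) (t : ℕ) :
    IndepFun (u t)
      (fun ω => zoAGDA f α β μ₁ μ₂ x₀ y₀ (fun s => u s ω) (fun s => v s ω) t) P :=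
  hu.indepFun_of_measurable (measurable_pi_lambda _ hv) huv fun _ hum hvm =>
    measurable_zoAGDA hf hum fun s _ => (measurable_pi_apply s).comp hvm

theorem indepFun_descentStep_zoAGDA (hf : HasLipschitzGradients f l)
    {u : ℕ → Ω → EuclideanSpace ℝ (Fin d₁)} {v : ℕ → Ω → EuclideanSpace ℝ (Fin d₂)}
    (hu : ∀ t, Measurable (u t)) (hv : IsUniformDirections v P)
    (huv : IndepFun (fun ω t => u t ω) (fun ω t => v t ω) P) (t : ℕ) :
    IndepFun (v t) (fun ω => descentStep f α μ₁
      (zoAGDA f α β μ₁ μ₂ x₀ y₀ (fun s => u s ω) (fun s => v s ω) t) (u t ω)) P :=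
  hv.indepFun_of_measurable (measurable_pi_lambda _ hu) huv.symm fun _ hvm hum =>
    have hum (s : ℕ) := (measurable_pi_apply s).comp hum
    measurable_descentStep hf (measurable_zoAGDA hf (fun s _ => hum s) hvm) (hum t)

theorem integral_potential_zoAGDA_succ_le_sub [NeZero d₁] [NeZero d₂]
    (hf : HasLipschitzGradients f l) (hPL : IsPLInY f μ) (hl : 0 < l) (hμ : 0 < μ)
    (h : IsAdmissible d₁ d₂ l μ α β μ₁ μ₂ ε)
    {u : ℕ → Ω → EuclideanSpace ℝ (Fin d₁)} {v : ℕ → Ω → EuclideanSpace ℝ (Fin d₂)}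
    (hu : IsUniformDirections u P) (hv : IsUniformDirections v P)
    (huv : IndepFun (fun ω t => u t ω) (fun ω t => v t ω) P)
    {Z : ℕ → Ω → EuclideanSpace ℝ (Fin d₁) × EuclideanSpace ℝ (Fin d₂)}
    (hZ : ∀ t ω, Z t ω = zoAGDA f α β μ₁ μ₂ x₀ y₀ (fun s => u s ω) (fun s => v s ω) t) {t : ℕ}
    (hε : ε < ∫ ω, ‖gradient (primalFun f) (Z t ω).1‖ ∂P) :
    ∫ ω, potential f (Z (t + 1) ω) ∂P ≤ ∫ ω, potential f (Z t ω) ∂P - α * ε ^ 2 / 4 := by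
  obtain rfl : Z = _ := funext₂ hZ
  have hZm := measurable_zoAGDA (α := α) (β := β) (μ₁ := μ₁) (μ₂ := μ₂) (x₀ := x₀) (y₀ := y₀)
    (t := t) hf (fun s _ => hu.measurable s) fun s _ => hv.measurable s
  have hZK := aeMemCompact_zoAGDA (α := α) (β := β) (μ₁ := μ₁) (μ₂ := μ₂) (x₀ := x₀) (y₀ := y₀)
    hf hu.aeMemCompact hv.aeMemCompact t
  have hgrad : Continuous fun p : EuclideanSpace ℝ (Fin d₁) × EuclideanSpace ℝ (Fin d₂) =>
      ‖gradient (primalFun f) p.1‖ :=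
    ((continuous_gradient_primalFun hf hPL hμ hl).comp continuous_fst).norm
  have hstep := integral_potential_ascentStep_descentStep_le hf hPL hl hμ h hZm (hu.measurable t)
    (hv.measurable t) hZK (hu.map_eq t) (hv.map_eq t)
    (indepFun_fst_zoAGDA hf hu hv.measurable huv t)
    (indepFun_descentStep_zoAGDA hf hu.measurable hv huv t)
  have hsq := (pow_le_pow_left₀ h.ε_pos.le hε.le 2).trans
    (sq_integral_le_integral_sq (hZK.integrable_comp hZm hgrad)
      (hZK.integrable_comp hZm (hgrad.pow 2)))
  have := mul_le_mul_of_nonneg_left hsq h.α_pos.le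
  change ∫ ω, potential f (ascentStep f β μ₂ (descentStep f α μ₁ _ _) _) ∂P ≤ _
  linarith

end Iterates

section Parameters

variable {d d₁ d₂ : ℕ} {l μ L κ α β θ μ₁ μ₂ ε : ℝ}

theorem mul_sq_div_two_mul_sqrt_le (hd : 0 < d) (hl : 0 < l) (hlL : l ≤ L) (hα : 0 < α)
    (hθ : 3 / 2 * α * (d ^ 2 * L ^ 2) ≤ θ) :
    α * d * l ^ 2 * (√α * ε / (2 * √θ)) ^ 2 ≤ α * ε ^ 2 / 6 := by
  have hd' : (1 : ℝ) ≤ d := by exact_mod_cast hd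
  have hθ₀ : 0 < θ := lt_of_lt_of_le (by have := hl.trans_le hlL; positivity) hθ
  have hθl : 3 / 2 * α * (d * l ^ 2) ≤ θ := by
    refine le_trans ?_ hθ
    gcongr
    exact le_self_pow₀ hd' two_ne_zero
  calc α * d * l ^ 2 * (√α * ε / (2 * √θ)) ^ 2
    _ = α * ε ^ 2 / (6 * θ) * (3 / 2 * α * (d * l ^ 2)) := by
        rw [div_pow, mul_pow, mul_pow, Real.sq_sqrt hα.le, Real.sq_sqrt hθ₀.le]
        field_simp
        ring
    _ ≤ α * ε ^ 2 / (6 * θ) * θ := by gcongr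
    _ = α * ε ^ 2 / 6 := by field_simp

theorem mul_sq_div_sqrt_mul_le (hd : 0 < d) (hl : 0 < l) (hlL : l ≤ L) (hα : 0 < α)
    (hβ : 0 < β) : β * d * l ^ 2 * (√α * ε / (√(3 * β) * d * L)) ^ 2 ≤ α * ε ^ 2 / 3 := by
  have hd' : (1 : ℝ) ≤ d := by exact_mod_cast hd
  have hL := hl.trans_le hlL
  have hdl : d * l ^ 2 ≤ d ^ 2 * L ^ 2 := by
    gcongr
    exact le_self_pow₀ hd' two_ne_zero
  calc β * d * l ^ 2 * (√α * ε / (√(3 * β) * d * L)) ^ 2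
    _ = α * ε ^ 2 / (3 * (d ^ 2 * L ^ 2)) * (d * l ^ 2) := by
        rw [div_pow, mul_pow, mul_pow, mul_pow, Real.sq_sqrt hα.le, Real.sq_sqrt (by positivity)]
        field_simp
    _ ≤ α * ε ^ 2 / (3 * (d ^ 2 * L ^ 2)) * (d ^ 2 * L ^ 2) := by gcongr
    _ = α * ε ^ 2 / 3 := by field_simp

theorem three_mul_add_add_le_six_mul (hl : 0 ≤ l) (hβl : β * l ≤ 1) :
    3 * (l + l ^ 2 / μ) + l + β * l ^ 2 ≤ 6 * (l + l ^ 2 / (2 * μ)) := by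
  have hhalf : l ^ 2 / (2 * μ) = l ^ 2 / μ / 2 := by rw [mul_comm, div_div]
  have : β * l * l ≤ 1 * l := by gcongr
  rw [hhalf]
  linarith

theorem isAdmissible_of_le (hd₁ : 0 < d₁) (hd₂ : 0 < d₂) (hl : 0 < l) (hμ : 0 < μ)
    (hL : L = l + l ^ 2 / (2 * μ)) (hκ : κ = l / μ) (hα₀ : 0 < α) (hβ₀ : 0 < β) (hε : 0 < ε)
    (hβ : β ≤ 1 / (4 * d₂ * L)) (hα : α ≤ min (β / (32 * κ ^ 2)) (1 / (10 * d₁ * L)))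
    (hθ : θ = (5 * d₁ * L + 3 / (2 * α) + 3 / 2 * L + d₂ * L) * d₁ ^ 2 * L ^ 2 * α ^ 2)
    (hμ₁ : μ₁ = √α * ε / (2 * √θ)) (hμ₂ : μ₂ = √α * ε / (√(3 * β) * d₂ * L)) :
    IsAdmissible d₁ d₂ l μ α β μ₁ μ₂ ε := by
  have hlL : l ≤ L := hL ▸ le_add_of_nonneg_right (by positivity)
  have hL₀ : 0 < L := hl.trans_le hlL
  have hκ₀ : 0 < κ := hκ ▸ div_pos hl hμ
  have hβL : β * (4 * d₂ * L) ≤ 1 := (le_div_iff₀ (by positivity)).1 hβ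
  have hαL : α * (10 * d₁ * L) ≤ 1 := (le_div_iff₀ (by positivity)).1 (hα.trans (min_le_right _ _))
  have hαβ : α * (32 * κ ^ 2) ≤ β := (le_div_iff₀ (by positivity)).1 (hα.trans (min_le_left _ _))
  have hβd₂l : β * d₂ * l ≤ 1 / 4 := by
    have : β * d₂ * l ≤ β * d₂ * L := by gcongr
    linarith
  have hθ₀ : 3 / 2 * α * (d₁ ^ 2 * L ^ 2) ≤ θ := by
    have : 0 ≤ (5 * d₁ * L + 3 / 2 * L + d₂ * L) * d₁ ^ 2 * L ^ 2 * α ^ 2 := by positivity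
    have : 3 / (2 * α) * α ^ 2 = 3 / 2 * α := by field_simp
    rw [hθ, ← this]
    linarith
  have hβl : β * l ≤ 1 / 4 :=
    le_trans (by gcongr; exact le_mul_of_one_le_right hβ₀.le (by exact_mod_cast hd₂)) hβd₂l
  have hcurv : 3 * (l + l ^ 2 / μ) + l + β * l ^ 2 ≤ 6 * L :=
    hL ▸ three_mul_add_add_le_six_mul hl.le (by linarith)
  have hθpos : 0 < θ := lt_of_lt_of_le (by positivity) hθ₀
  refine ⟨hα₀, hβ₀, hε, hμ₁ ▸ by positivity, hμ₂ ▸ by positivity, ?_, by linarith, ?_, ?_⟩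
  · have : α * d₁ * (3 * (l + l ^ 2 / μ) + l + β * l ^ 2) ≤ α * d₁ * (6 * L) := by gcongr
    linarith [show 0 < α * d₁ * L by positivity]
  · rw [← hκ]
    linarith [show 0 < α * κ ^ 2 by positivity]
  · rw [hμ₁, hμ₂]
    linarith [mul_sq_div_two_mul_sqrt_le (ε := ε) hd₁ hl hlL hα₀ hθ₀,
      mul_sq_div_sqrt_mul_le (ε := ε) hd₂ hl hlL hα₀ hβ₀, show 0 < α * ε ^ 2 by positivity]

end Parameters

section Complexity

theorem natCast_le_div_of_forall_lt_succ_le_sub {V : ℕ → ℝ} {δ m : ℝ} (hδ : 0 < δ)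
    (hm : ∀ t, m ≤ V t) {N : ℕ} (h : ∀ t < N, V (t + 1) ≤ V t - δ) : (N : ℝ) ≤ (V 0 - m) / δ := by
  have htelescope : ∀ n ≤ N, V n ≤ V 0 - n * δ := by
    intro n hn
    induction n with
    | zero => simp
    | succ n ih =>
      push_cast
      linarith [h n hn, ih (Nat.le_of_succ_le hn)]
  rw [le_div_iff₀ hδ]
  linarith [htelescope N le_rfl, hm N]

theorem exists_isLeast_and_le_of_succ_le_sub {a V : ℕ → ℝ} {ε δ m : ℝ} (hδ : 0 < δ)
    (hm : ∀ t, m ≤ V t) (h : ∀ t, ε < a t → V (t + 1) ≤ V t - δ) :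
    ∃ T : ℕ, IsLeast {t | a t ≤ ε} T ∧ (T : ℝ) ≤ (V 0 - m) / δ := by
  have hle (N : ℕ) (hN : ∀ t < N, ε < a t) : (N : ℝ) ≤ (V 0 - m) / δ :=
    natCast_le_div_of_forall_lt_succ_le_sub hδ hm fun t ht => h t (hN t ht)
  have hex : ∃ t, a t ≤ ε := by
    by_contra! hlt
    obtain ⟨N, hN⟩ := exists_nat_gt ((V 0 - m) / δ)
    exact (hle N fun t _ => hlt t).not_gt hN
  classical
  exact ⟨Nat.find hex, ⟨Nat.find_spec hex, fun t ht => Nat.find_min' hex ht⟩,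
    hle _ fun t ht => not_le.1 (Nat.find_min hex ht)⟩

theorem two_mul_le_potential {d₁ d₂ : ℕ}
    {f : EuclideanSpace ℝ (Fin d₁) → EuclideanSpace ℝ (Fin d₂) → ℝ} {μ Φstar : ℝ}
    (hPL : IsPLInY f μ) (hΦstar : Φstar ∈ lowerBounds (Set.range (primalFun f)))
    (p : EuclideanSpace ℝ (Fin d₁) × EuclideanSpace ℝ (Fin d₂)) : 2 * Φstar ≤ potential f p := by
  rw [potential]
  linarith [hΦstar (Set.mem_range_self p.1), hPL.le_primalFun p.1 p.2]

theorem theorem1_general {d₁ d₂ : ℕ} (hd₁ : 0 < d₁) (hd₂ : 0 < d₂)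
    (f : EuclideanSpace ℝ (Fin d₁) → EuclideanSpace ℝ (Fin d₂) → ℝ)
    (l μ : ℝ) (hl : 0 < l) (hμ : 0 < μ)
    (hf : HasLipschitzGradients f l) (hPL : IsPLInY f μ)
    (Φstar : ℝ) (hΦstar : Φstar ∈ lowerBounds (Set.range (primalFun f)))
    (α β μ₁ μ₂ ε : ℝ) (hadm : IsAdmissible d₁ d₂ l μ α β μ₁ μ₂ ε)
    (x₀ : EuclideanSpace ℝ (Fin d₁)) (y₀ : EuclideanSpace ℝ (Fin d₂))
    {Ω : Type*} [MeasurableSpace Ω] (P : Measure Ω) [IsProbabilityMeasure P]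
    (u : ℕ → Ω → EuclideanSpace ℝ (Fin d₁)) (v : ℕ → Ω → EuclideanSpace ℝ (Fin d₂))
    (hu : IsUniformDirections u P) (hv : IsUniformDirections v P)
    (huv : IndepFun (fun ω t => u t ω) (fun ω t => v t ω) P)
    (x : ℕ → Ω → EuclideanSpace ℝ (Fin d₁))
    (hx : ∀ t ω, x t ω =
      (zoAGDA f α β μ₁ μ₂ x₀ y₀ (fun s => u s ω) (fun s => v s ω) t).1) :
    Differentiable ℝ (primalFun f) ∧
    (∀ t, Integrable (fun ω => ‖gradient (primalFun f) (x t ω)‖) P) ∧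
    ∃ T : ℕ, IsLeast {t : ℕ | ∫ ω, ‖gradient (primalFun f) (x t ω)‖ ∂P ≤ ε} T ∧
      (T : ℝ) ≤ 4 * (3 * primalFun f x₀ - f x₀ y₀ - 2 * Φstar) / (α * ε ^ 2) := by
  have : NeZero d₁ := .of_pos hd₁
  have : NeZero d₂ := .of_pos hd₂
  let Z (t : ℕ) (ω : Ω) := zoAGDA f α β μ₁ μ₂ x₀ y₀ (fun s => u s ω) (fun s => v s ω) t
  have integrable_comp_Z (t : ℕ) {F : _ → ℝ} (hF : Continuous F) :
      Integrable (fun ω => F (Z t ω)) P :=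
    (aeMemCompact_zoAGDA hf hu.aeMemCompact hv.aeMemCompact t).integrable_comp
      (measurable_zoAGDA hf (fun s _ => hu.measurable s) fun s _ => hv.measurable s) hF
  have hlower (t : ℕ) : 2 * Φstar ≤ ∫ ω, potential f (Z t ω) ∂P := by
    simpa using integral_mono (integrable_const (2 * Φstar))
      (integrable_comp_Z t (continuous_potential hf hPL hμ))
      fun ω => two_mul_le_potential hPL hΦstar (Z t ω)
  have hδ : 0 < α * ε ^ 2 / 4 := by have := hadm.α_pos; have := hadm.ε_pos; positivity
  obtain rfl : x = fun t ω => (Z t ω).1 := funext₂ hx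
  obtain ⟨T, hT, hTle⟩ := exists_isLeast_and_le_of_succ_le_sub hδ hlower fun t =>
    integral_potential_zoAGDA_succ_le_sub hf hPL hl hμ hadm hu hv huv (Z := Z) (fun _ _ => rfl)
  refine ⟨differentiable_primalFun hf hPL hμ, fun t => integrable_comp_Z t
    ((continuous_gradient_primalFun hf hPL hμ hl).comp continuous_fst).norm, T, hT, ?_⟩
  have hV₀ : ∫ ω, potential f (Z 0 ω) ∂P = 3 * primalFun f x₀ - f x₀ y₀ := by
    simp [Z, zoAGDA, potential]
  rwa [hV₀, div_div_eq_mul_div, mul_comm _ (4 : ℝ)] at hTle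

end Complexity

theorem theorem1 {d₁ d₂ : ℕ} (hd₁ : 0 < d₁) (hd₂ : 0 < d₂)
    (f : EuclideanSpace ℝ (Fin d₁) → EuclideanSpace ℝ (Fin d₂) → ℝ)
    (l μ : ℝ) (hl : 0 < l) (hμ : 0 < μ)
    (hsmooth : HasLipschitzGradients f l) (hPL : IsPLInY f μ)
    (Φstar : ℝ) (hΦstar : IsLeast (Set.range (primalFun f)) Φstar)
    (L κ : ℝ) (hL : L = l + l ^ 2 / (2 * μ)) (hκ : κ = l / μ)
    (α β ε : ℝ) (hα₀ : 0 < α) (hβ₀ : 0 < β) (hε : 0 < ε)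
    (hβ : β ≤ 1 / (4 * d₂ * L))
    (hα : α ≤ min (β / (32 * κ ^ 2)) (1 / (10 * d₁ * L)))
    (θ₁ μ₁ μ₂ : ℝ)
    (hθ₁ : θ₁ = (5 * d₁ * L + 3 / (2 * α) + 3 / 2 * L + d₂ * L) * d₁ ^ 2 * L ^ 2 * α ^ 2)
    (hμ₁ : μ₁ = √α * ε / (2 * √θ₁))
    (hμ₂ : μ₂ = √α * ε / (√(3 * β) * d₂ * L))
    (x₀ : EuclideanSpace ℝ (Fin d₁)) (y₀ : EuclideanSpace ℝ (Fin d₂))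
    -- the random directions: independent, uniform on the unit spheres
    {Ω : Type*} [MeasurableSpace Ω] (P : Measure Ω) [IsProbabilityMeasure P]
    (u : ℕ → Ω → EuclideanSpace ℝ (Fin d₁)) (v : ℕ → Ω → EuclideanSpace ℝ (Fin d₂))
    (hu_meas : ∀ t, Measurable (u t)) (hv_meas : ∀ t, Measurable (v t))
    (hu_law : ∀ t, P.map (u t) = uniformSphere d₁)
    (hv_law : ∀ t, P.map (v t) = uniformSphere d₂)
    (hu_indep : iIndepFun u P) (hv_indep : iIndepFun v P)
    (huv_indep : IndepFun (fun ω t => u t ω) (fun ω t => v t ω) P)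
    (x : ℕ → Ω → EuclideanSpace ℝ (Fin d₁))
    (hx : ∀ t ω, x t ω =
      (zoAGDA f α β μ₁ μ₂ x₀ y₀ (fun s => u s ω) (fun s => v s ω) t).1) :
    Differentiable ℝ (primalFun f) ∧
    (∀ t, Integrable (fun ω => ‖gradient (primalFun f) (x t ω)‖) P) ∧
    ∃ T : ℕ, IsLeast {t : ℕ | ∫ ω, ‖gradient (primalFun f) (x t ω)‖ ∂P ≤ ε} T ∧
      (T : ℝ) ≤ 4 * (3 * primalFun f x₀ - f x₀ y₀ - 2 * Φstar) / (α * ε ^ 2) :=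
  theorem1_general hd₁ hd₂ f l μ hl hμ hsmooth hPL Φstar hΦstar.2 α β μ₁ μ₂ ε
    (isAdmissible_of_le hd₁ hd₂ hl hμ hL hκ hα₀ hβ₀ hε hβ hα hθ₁ hμ₁ hμ₂) x₀ y₀ P u v
    ⟨hu_meas, hu_law, hu_indep⟩ ⟨hv_meas, hv_law, hv_indep⟩ huv_indep x hx
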